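/- Let $X$ be a real or complex Banach space with dual $X^*$ and dual unit ball $B_{X^*}=\{x^*\in X^*:\|x^*\|\le 1\}$, and let $A\subset X$ be a bounded set. Sequences are indexed by $\mathbb N=\{1,2,\dots\}$, and suprema of empty sets are $0$. For a bounded sequence $(x_k)$ in $X$ put $$\operatorname{ca}(x_k)=\inf_{n}\sup\{\|x_k-x_l\|: k,l\ge n\},\qquad \operatorname{cca}(x_k)=\operatorname{ca}\Big(\tfrac1k\sum_{i=1}^k x_i\Big),$$ $$\widetilde{\operatorname{cca}}(x_k)=\inf\{\operatorname{cca}(x_{k_n}): (x_{k_n})\text{ is a subsequence of }(x_k)\},$$ $$\operatorname{wbs}(A)=\sup\{\widetilde{\operatorname{cca}}(x_k): (x_k)\subset A\text{ is weakly convergent in }X\}.$$ For a sequence $(x_k)$ weakly converging to $x\in X$ let $\operatorname{wu}(x_k)$ be the infimum of all $\varepsilon>0$ such that $$\exists n\in\mathbb N\ \forall x^*\in B_{X^*}:\ \#\{k\in\mathbb N: |x^*(x_k-x)|>\varepsilon\}\le n,$$ and put $$\widetilde{\operatorname{wu}}(x_k)=\inf\{\operatorname{wu}(x_{k_n}): (x_{k_n})\text{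 is a subsequence of }(x_k)\},$$ $$\operatorname{swu}(A)=\sup\{\widetilde{\operatorname{wu}}(x_k): (x_k)\subset A\text{ is weakly convergent in }X\}.$$ A bounded sequence $(y_k)$ generates an $\ell_1$-spreading model with $\delta>0$ if $\big\|\sum_{i\in F}\alpha_i y_i\big\|\ge\delta\sum_{i\in F}|\alpha_i|$ for every nonempty finite $F\subset\mathbb N$ with $\#F\le\min F$ and all real numbers $(\alpha_i)_{i\in F}$. Let $\operatorname{sm}(A)$ be the supremum of all $\delta>0$ for which there are a sequence $(x_k)$ in $A$ and $x\in X$ such that $(x_k)$ converges weakly to $x$ and $(x_k-x)$ generates an $\ell_1$-spreading model with $\delta$. Then $$\operatorname{sm}(A)\le\tfrac12\operatorname{wbs}(A)\le\operatorname{swu}(A)\le 2\operatorname{sm}(A).$$ -/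

import Mathlib

open Filter Topology
open scoped ENNReal

/-!
Sequences `(x_k)_{k ≥ 1}` are represented by functions `x : ℕ → E`, the value `x k` being the term
of index `k + 1`. All the quantities are non-negative and take values in `[0, ∞]`, so that every
supremum and infimum is a genuine one, and the supremum of the empty set is `0`.
-/

namespace BanachSaks

section Norm

variable {E : Type*} [NormedAddCommGroup E]

/-- `ca (x_k) = inf_n sup {‖x_k - x_l‖ : k, l ≥ n}`. -/
noncomputable def ca (x : ℕ → E) : ℝ≥0∞ :=
  ⨅ n : ℕ, ⨆ (k : ℕ) (_ : n ≤ k) (l : ℕ) (_ : n ≤ l), ‖x k - x l‖ₑ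

end Norm

section Scalars

variable (𝕜 : Type*) [RCLike 𝕜] {E : Type*} [NormedAddCommGroup E] [NormedSpace 𝕜 E]

/-- The sequence of Cesàro means; the term of index `n + 1` is
`(x_1 + ... + x_{n+1}) / (n + 1)`. -/
noncomputable def cesaroMean (x : ℕ → E) (n : ℕ) : E :=
  ((n : 𝕜) + 1)⁻¹ • ∑ i ∈ Finset.range (n + 1), x i

/-- `cca (x_k)`: the quantity `ca` of the sequence of Cesàro means. -/
noncomputable def cca (x : ℕ → E) : ℝ≥0∞ :=
  ca (cesaroMean 𝕜 x)

/-- The infimum of `cca` over all subsequences. -/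
noncomputable def tcca (x : ℕ → E) : ℝ≥0∞ :=
  ⨅ (φ : ℕ → ℕ) (_ : StrictMono φ), cca 𝕜 (x ∘ φ)

/-- The sequence `x` converges to `a` in the weak topology of `E`. -/
def WeaklyTendsto (x : ℕ → E) (a : E) : Prop :=
  Tendsto (fun k => toWeakSpace 𝕜 E (x k)) atTop (𝓝 (toWeakSpace 𝕜 E a))

/-- `wbs A`: the supremum of `tcca (x_k)` over all weakly convergent sequences in `A`
(the weak limit may lie outside `A`). -/
noncomputable def wbs (A : Set E) : ℝ≥0∞ :=
  ⨆ (x : ℕ → E) (_ : ∀ k, x k ∈ A) (_ : ∃ a : E, WeaklyTendsto 𝕜 x a), tcca 𝕜 x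

/-- There is a natural number `n` such that, for every functional `f` in the closed unit ball of
the dual, at most `n` indices `k` satisfy `|f (x_k - a)| > ε`. -/
def UniformlyWeaklyWithin (x : ℕ → E) (a : E) (ε : ℝ) : Prop :=
  ∃ n : ℕ, ∀ f : StrongDual 𝕜 E, ‖f‖ ≤ 1 → {k : ℕ | ε < ‖f (x k - a)‖}.encard ≤ (n : ℕ∞)

/-- `wu (x_k)` for a sequence with weak limit `a`. (The weak limit is unique, so the
argument `a` carries no additional information.) -/
noncomputable def wu (x : ℕ → E) (a : E) : ℝ≥0∞ :=
  ⨅ (ε : ℝ) (_ : 0 < ε) (_ : UniformlyWeaklyWithin 𝕜 x a ε), ENNReal.ofReal ε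

/-- The infimum of `wu` over all subsequences (which have the same weak limit `a`). -/
noncomputable def twu (x : ℕ → E) (a : E) : ℝ≥0∞ :=
  ⨅ (φ : ℕ → ℕ) (_ : StrictMono φ), wu 𝕜 (x ∘ φ) a

/-- `swu A`: the supremum of `twu (x_k)` over all weakly convergent sequences in `A`. -/
noncomputable def swu (A : Set E) : ℝ≥0∞ :=
  ⨆ (x : ℕ → E) (_ : ∀ k, x k ∈ A) (a : E) (_ : WeaklyTendsto 𝕜 x a), twu 𝕜 x a

/-- The sequence `x` generates an `ℓ₁`-spreading model with constant `δ`: for every finite set `F`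
of indices with `#F ≤ min F` and all real coefficients,
`‖∑_{i ∈ F} α_i x_i‖ ≥ δ ∑_{i ∈ F} |α_i|`. Since `x i` is the term of index `i + 1`,
the condition `#F ≤ min F` reads `#F ≤ i + 1` for all `i ∈ F`. -/
def GeneratesL1SpreadingModel (x : ℕ → E) (δ : ℝ) : Prop :=
  ∀ F : Finset ℕ, (∀ i ∈ F, F.card ≤ i + 1) → ∀ α : ℕ → ℝ,
    δ * ∑ i ∈ F, |α i| ≤ ‖∑ i ∈ F, (α i : 𝕜) • x i‖

/-- `sm A`: the supremum of all `δ > 0` such that, for some sequence `x` in `A` weakly converging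
to some `a`, the sequence `(x_k - a)` generates an `ℓ₁`-spreading model with constant `δ`. -/
noncomputable def sm (A : Set E) : ℝ≥0∞ :=
  ⨆ (δ : ℝ) (_ : 0 < δ)
    (_ : ∃ (x : ℕ → E) (a : E), (∀ k, x k ∈ A) ∧ WeaklyTendsto 𝕜 x a ∧
      GeneratesL1SpreadingModel 𝕜 (fun k => x k - a) δ), ENNReal.ofReal δ

end Scalars

end BanachSaks

/-! For `swu ≤ 2 sm`, let `y` be weakly null with no subsequence uniformly weakly within `c`.
Functionals in the dual ball then have real part above `c' < c` on arbitrarily many terms of each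
subsequence. Iterated ultrafilter limits (`exists_strictMono_separated`), with compactness of the
dual ball, give a subsequence on which every subset `G` of an admissible `F` has a functional that
is above `c'` on `G` and at most `η` on `F \ G`. Testing with `G` the set of positive coefficients
yields the lower `ℓ₁`-estimate with constant `(c' - η) / 2`.

For `wbs ≤ 2 swu`, a functional exceeds `ε` on boundedly many terms, so Cesàro means end up within
about `ε` of the weak limit (`norm_cesaroMean_le`); two of them differ by about `2ε`.

For `2 sm ≤ wbs`, the difference of two means of very different lengths has coefficients of
`ℓ₁`-norm nearly 2. On a sparse subsequence nearly all the indices involved are admissible, so the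
norm is nearly `2δ` (`GeneratesL1SpreadingModel.two_mul_le_cca`). -/

namespace BanachSaks

/-! ### Combinatorics: separating subsets of admissible sets by ultrafilter diagonalisation. -/

section Diagonal

/-- Diagonalisation along an ultrafilter: if `P (j + 1) s` forces `P j (insert k s)` for almost all
`k`, then along a suitable subsequence `P j` holds on every set starting sufficiently late. -/
theorem exists_strictMono_of_eventually_insert {U : Filter ℕ} [U.NeBot] (hU : U ≤ atTop)
    (P : ℕ → Finset ℕ → Prop)
    (hP : ∀ j s, P (j + 1) s → ∀ᶠ k in U, P j (insert k s)) :
    ∃ φ : ℕ → ℕ, StrictMono φ ∧ ∀ (F : Finset ℕ) (j : ℕ), (∀ i ∈ F, j + F.card ≤ i + 1) →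
      P (j + F.card) ∅ → P j (F.image φ) := by
  have hnext : ∀ s : Finset ℕ, ∃ k, (∀ i ∈ s, i < k) ∧
      ∀ t ∈ s.powerset, ∀ j ∈ Finset.range (s.card + 1), P (j + 1) t → P j (insert k t) := by
    intro s
    have h1 : ∀ᶠ k in U, ∀ i ∈ s, i < k :=
      (Finset.eventually_all s).2 fun i _ => hU (eventually_gt_atTop i)
    have h2 : ∀ᶠ k in U, ∀ t ∈ s.powerset, ∀ j ∈ Finset.range (s.card + 1),
        P (j + 1) t → P j (insert k t) := by
      refine (Finset.eventually_all _).2 fun t _ => (Finset.eventually_all _).2 fun j _ => ?_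
      by_cases h : P (j + 1) t
      · exact (hP j t h).mono fun _ hk _ => hk
      · exact Eventually.of_forall fun _ h' => absurd h' h
    exact (h1.and h2).exists
  choose next hlt hstep using hnext
  let S : ℕ → Finset ℕ := fun n => Nat.rec ∅ (fun _ s => insert (next s) s) n
  have hS : ∀ n, S (n + 1) = insert (next (S n)) (S n) := fun _ => rfl
  have hSmono : Monotone S := monotone_nat_of_le_succ fun n => by
    rw [hS]; exact Finset.subset_insert _ _
  have hmem : ∀ {m n}, m < n → next (S m) ∈ S n := fun {m n} h =>
    hSmono (Nat.succ_le_of_lt h) (by rw [Nat.succ_eq_add_one, hS]; exact Finset.mem_insert_self _ _)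
  have hcard : ∀ n, (S n).card = n := by
    intro n
    induction n with
    | zero => rfl
    | succ n ih =>
      rw [hS, Finset.card_insert_of_notMem fun h => (hlt _ _ h).false, ih]
  refine ⟨fun n => next (S n), fun m n h => hlt _ _ (hmem h), fun F => ?_⟩
  induction F using Finset.induction_on_max with
  | empty => intro j _ h; simpa using h
  | insert a F ha ih =>
    intro j hF h0
    have haF : a ∉ F := fun h => (ha a h).false
    rw [Finset.card_insert_of_notMem haF] at hF h0
    rw [Finset.image_insert]
    -- The largest index is inserted last. Admissibility at `a` gives `j ≤ a = #(S a)`, within the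
    -- range of levels handled when `next (S a)` was chosen.
    refine hstep (S a) _ (Finset.mem_powerset.2 ?_) j ?_ (ih (j + 1) ?_ ?_)
    · intro k hk
      obtain ⟨i, hi, rfl⟩ := Finset.mem_image.1 hk
      exact hmem (ha i hi)
    · rw [hcard, Finset.mem_range]
      have := hF a (Finset.mem_insert_self _ _)
      omega
    · intro i hi
      have := hF i (Finset.mem_insert_of_mem hi)
      omega
    · rwa [show j + 1 + F.card = j + (F.card + 1) by ring]

variable (U : Ultrafilter ℕ) (K : Set (ℕ → ℝ)) (c η : ℝ)

/-- For `U`-almost all `k₁`, ..., `U`-almost all `k_p`, some member of `K` exceeds `c` on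
`G ∪ {k₁, ..., k_p}` and is at most `η` on `H`. -/
def AlmostSeparated : ℕ → Finset ℕ → Finset ℕ → Prop
  | 0, G, H => ∃ g ∈ K, (∀ i ∈ G, c < g i) ∧ ∀ i ∈ H, g i ≤ η
  | p + 1, G, H => ∀ᶠ k in (U : Filter ℕ), AlmostSeparated p (insert k G) H

variable {U K c η}

/-- For an ultrafilter, failing to hold almost always means almost always failing. Hence a common
choice of `k₁, ..., k_p` serves `h` and all the finitely many negations, and the resulting member of
`K` must exceed `η` at each `t`. -/
theorem AlmostSeparated.exists_lt_of_forall_not {p : ℕ} {G H T : Finset ℕ}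
    (h : AlmostSeparated U K c η p G H)
    (hT : ∀ t ∈ T, ¬ AlmostSeparated U K c η p G (insert t H)) :
    ∃ g ∈ K, ∀ t ∈ T, η < g t := by
  induction p generalizing G with
  | zero =>
    obtain ⟨g, hg, hG, hH⟩ := h
    refine ⟨g, hg, fun t ht => ?_⟩
    by_contra! hle
    exact hT t ht ⟨g, hg, hG, by simpa [hle] using hH⟩
  | succ p ih =>
    have hT' : ∀ᶠ k in (U : Filter ℕ), ∀ t ∈ T,
        ¬ AlmostSeparated U K c η p (insert k G) (insert t H) :=
      (Finset.eventually_all T).2 fun t ht => Ultrafilter.eventually_not.2 (hT t ht)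
    obtain ⟨k, hk, hk'⟩ := (Eventually.and h hT').exists
    exact ih hk hk'

/-- Otherwise the bad `k` form an infinite set, and some member of `K` would exceed `η` on any
finite part of it, against `hK`. -/
theorem AlmostSeparated.eventually_insert (hU : (U : Filter ℕ) ≤ atTop)
    (hK : ∀ T : Set ℕ, T.Infinite → ∃ s : Finset ℕ, ↑s ⊆ T ∧ ¬ ∃ g ∈ K, ∀ t ∈ s, η < g t)
    {p : ℕ} {G H : Finset ℕ} (h : AlmostSeparated U K c η p G H) :
    ∀ᶠ k in (U : Filter ℕ), AlmostSeparated U K c η p G (insert k H) := by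
  by_contra hcon
  have hT := Ultrafilter.eventually_not.2 hcon
  obtain ⟨s, hsT, hs⟩ := hK {k | ¬ AlmostSeparated U K c η p G (insert k H)}
    (Nat.frequently_atTop_iff_infinite.1 (hT.frequently.filter_mono hU))
  exact hs (h.exists_lt_of_forall_not fun t ht => hsT ht)

theorem almostSeparated_empty (hU : (U : Filter ℕ) ≤ atTop)
    (hK : ∀ φ : ℕ → ℕ, StrictMono φ → ∀ p : ℕ, ∃ g ∈ K, ∃ F : Finset ℕ, F.card = p ∧
      ∀ i ∈ F, c < g (φ i)) (p : ℕ) :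
    AlmostSeparated U K c η p ∅ ∅ := by
  by_contra hp
  obtain ⟨φ, hφ, h⟩ := exists_strictMono_of_eventually_insert hU
    (fun j s => ¬ AlmostSeparated U K c η j s ∅)
    (fun j s hs => Ultrafilter.eventually_not.2 hs)
  -- Shifting by `p` makes every `p`-element set of indices admissible.
  obtain ⟨g, hg, F, rfl, hF⟩ := hK (fun k => φ (k + p)) (hφ.comp (add_left_strictMono)) p
  have hc : (F.image (· + F.card)).card = F.card :=
    Finset.card_image_of_injective _ (add_left_injective _)
  refine h (F.image (· + F.card)) 0 ?_ (by rwa [hc, zero_add]) ⟨g, hg, ?_, by simp⟩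
  · intro i hi
    obtain ⟨k, -, rfl⟩ := Finset.mem_image.1 hi
    rw [hc]; omega
  · simpa using hF

/-- A relatively compact family of null sequences which is large on `p` indices along every
subsequence, for every `p`, arbitrarily separates the subsets of admissible sets along some
subsequence. -/
theorem exists_strictMono_separated
    (hη : ∀ T : Set ℕ, T.Infinite → ∃ s : Finset ℕ, ↑s ⊆ T ∧ ¬ ∃ g ∈ K, ∀ t ∈ s, η < g t)
    (hc : ∀ φ : ℕ → ℕ, StrictMono φ → ∀ p : ℕ, ∃ g ∈ K, ∃ F : Finset ℕ, F.card = p ∧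
      ∀ i ∈ F, c < g (φ i)) :
    ∃ φ : ℕ → ℕ, StrictMono φ ∧ ∀ F : Finset ℕ, (∀ i ∈ F, F.card ≤ i + 1) → ∀ G ⊆ F,
      ∃ g ∈ K, (∀ i ∈ G, c < g (φ i)) ∧ ∀ i ∈ F \ G, g (φ i) ≤ η := by
  have hU : (hyperfilter ℕ : Filter ℕ) ≤ atTop := Nat.hyperfilter_le_atTop
  -- Level `j` leaves room for up to `j` further large indices. A new index put in `G` uses one of
  -- them; put outside `G`, it is free by `eventually_insert`.
  obtain ⟨φ, hφ, h⟩ := exists_strictMono_of_eventually_insert hU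
    (fun j s => ∀ G ∈ s.powerset, ∀ p ∈ Finset.range (j + 1),
      AlmostSeparated (hyperfilter ℕ) K c η p G (s \ G)) (by
    intro j s hs
    have h1 : ∀ᶠ k in (hyperfilter ℕ : Filter ℕ), ∀ G ∈ s.powerset, ∀ p ∈ Finset.range (j + 1),
        AlmostSeparated (hyperfilter ℕ) K c η p (insert k G) (s \ G) :=
      (Finset.eventually_all _).2 fun G hG => (Finset.eventually_all _).2 fun p hp =>
        hs G hG (p + 1) (by simpa using hp)
    have h2 : ∀ᶠ k in (hyperfilter ℕ : Filter ℕ), ∀ G ∈ s.powerset, ∀ p ∈ Finset.range (j + 1),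
        AlmostSeparated (hyperfilter ℕ) K c η p G (insert k (s \ G)) :=
      (Finset.eventually_all _).2 fun G hG => (Finset.eventually_all _).2 fun p hp =>
        (hs G hG p (by simp at hp ⊢; omega)).eventually_insert hU hη
    have h3 : ∀ᶠ k in (hyperfilter ℕ : Filter ℕ), ∀ i ∈ s, i < k :=
      (Finset.eventually_all s).2 fun i _ => hU (eventually_gt_atTop i)
    filter_upwards [h1, h2, h3] with k h1 h2 h3 G hG p hp
    have hks : k ∉ s := fun h => (h3 k h).false
    rw [Finset.mem_powerset] at hG
    by_cases hkG : k ∈ G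
    · have := h1 (G.erase k) (by rw [Finset.mem_powerset]; grind) p hp
      rwa [Finset.insert_erase hkG,
        show s \ G.erase k = insert k s \ G by ext i; grind] at this
    · have := h2 G (by rw [Finset.mem_powerset]; grind) p hp
      rwa [show insert k (s \ G) = insert k s \ G by ext i; grind] at this)
  refine ⟨φ, hφ, fun F hF G hGF => ?_⟩
  obtain ⟨g, hg, h1, h2⟩ := h F 0 (by simpa using hF)
    (by simpa using fun p _ => almostSeparated_empty hU hc p) (G.image φ)
    (Finset.mem_powerset.2 (Finset.image_subset_image hGF)) 0 (by simp)
  refine ⟨g, hg, fun i hi => h1 _ (Finset.mem_image_of_mem _ hi), fun i hi => h2 _ ?_⟩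
  rw [← Finset.image_sdiff_of_injOn hφ.injective.injOn hGF]
  exact Finset.mem_image_of_mem _ hi

end Diagonal

/-! ### Spreading models from failure of uniform weak convergence: `swu ≤ 2 sm`. -/

section SpreadingModel

variable {𝕜 : Type*} [RCLike 𝕜] {E : Type*} [NormedAddCommGroup E] [NormedSpace 𝕜 E]

theorem WeaklyTendsto.tendsto_apply {x : ℕ → E} {a : E} (h : WeaklyTendsto 𝕜 x a)
    (f : StrongDual 𝕜 E) : Tendsto (fun k => f (x k)) atTop (𝓝 (f a)) :=
  ((WeakBilin.eval_continuous (topDualPairing 𝕜 E).flip f).tendsto _).comp h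

theorem WeaklyTendsto.comp {x : ℕ → E} {a : E} (h : WeaklyTendsto 𝕜 x a) {φ : ℕ → ℕ}
    (hφ : StrictMono φ) : WeaklyTendsto 𝕜 (x ∘ φ) a :=
  Tendsto.comp (f := φ) (show Tendsto _ _ _ from h) hφ.tendsto_atTop

/-- By the Banach-Alaoglu theorem, functionals in the dual unit ball cannot stay large on a weakly
null sequence along arbitrarily long pieces of an infinite set of indices. -/
theorem exists_finset_forall_exists_re_le {y : ℕ → E}
    (hy : ∀ f : StrongDual 𝕜 E, Tendsto (fun k => f (y k)) atTop (𝓝 0)) {η : ℝ} (hη : 0 < η)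
    {T : Set ℕ} (hT : T.Infinite) :
    ∃ s : Finset ℕ, ↑s ⊆ T ∧ ∀ f : StrongDual 𝕜 E, ‖f‖ ≤ 1 → ∃ t ∈ s, RCLike.re (f (y t)) ≤ η := by
  have hcl : ∀ t : T, IsClosed {f : WeakDual 𝕜 E | η ≤ RCLike.re (f (y t))} := fun t =>
    isClosed_le continuous_const (RCLike.continuous_re.comp (WeakDual.eval_continuous _))
  obtain ⟨u, hu⟩ := (WeakDual.isCompact_closedBall (0 : StrongDual 𝕜 E) 1).elim_finite_subfamily_closed
    _ hcl (by
      rw [Set.eq_empty_iff_forall_notMem]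
      rintro f ⟨-, hf⟩
      have hre : Tendsto (fun k => RCLike.re (f (y k))) atTop (𝓝 0) := by
        rw [← map_zero (RCLike.re : 𝕜 →+ ℝ)]
        exact (RCLike.continuous_re.tendsto _).comp (hy (WeakDual.toStrongDual f))
      obtain ⟨k, hk, hkT⟩ := ((Nat.frequently_atTop_iff_infinite.2 hT).and_eventually
        (hre.eventually_lt_const hη)).exists
      exact hkT.not_ge (Set.mem_iInter.1 hf ⟨k, hk⟩))
  refine ⟨u.map (Function.Embedding.subtype _), by simp, fun f hf => ?_⟩
  by_contra! hcon
  refine (Set.eq_empty_iff_forall_notMem.1 hu) (StrongDual.toWeakDual f) ⟨by simpa using hf, ?_⟩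
  simp only [Set.mem_iInter]
  intro t ht
  exact (hcon t (Finset.mem_map_of_mem _ ht)).le

/-- Finitely many directions detect, up to a factor `r < 1`, the modulus of every scalar. -/
theorem exists_finset_re_mul_ge (𝕜 : Type*) [RCLike 𝕜] {r : ℝ} (hr : r < 1) :
    ∃ s : Finset 𝕜, (∀ u ∈ s, ‖u‖ = 1) ∧ ∀ z : 𝕜, ∃ u ∈ s, r * ‖z‖ ≤ RCLike.re (u * z) := by
  have hopen : ∀ u : 𝕜, IsOpen {z : 𝕜 | r < RCLike.re (star u * z)} := fun u =>
    isOpen_lt continuous_const (RCLike.continuous_re.comp (continuous_const.mul continuous_id))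
  have hself : ∀ u : 𝕜, ‖u‖ = 1 → star u * u = 1 := fun u hu => by
    simp [RCLike.conj_mul, hu]
  obtain ⟨s, hs, hcov⟩ := (isCompact_sphere (0 : 𝕜) 1).elim_nhds_subcover
    (fun u => {z : 𝕜 | r < RCLike.re (star u * z)})
    (fun u hu => (hopen u).mem_nhds (by
      rw [Set.mem_ofPred_eq, hself u (by simpa using hu), RCLike.one_re]; exact hr))
  have hex : ∀ z : 𝕜, ‖z‖ = 1 → ∃ u ∈ s, r < RCLike.re (star u * z) := fun z hz => by
    simpa using hcov (show z ∈ Metric.sphere (0 : 𝕜) 1 by simpa using hz)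
  classical
  refine ⟨s.image star, ?_, fun z => ?_⟩
  · intro u hu
    obtain ⟨v, hv, rfl⟩ := Finset.mem_image.1 hu
    simpa using hs v hv
  · rcases eq_or_ne z 0 with rfl | hz
    · obtain ⟨u, hu, -⟩ := hex 1 (by simp)
      exact ⟨_, Finset.mem_image_of_mem _ hu, by simp⟩
    · have hz' : 0 < ‖z‖ := norm_pos_iff.2 hz
      obtain ⟨u, hu, h⟩ := hex ((‖z‖⁻¹ : ℝ) * z) (by
        rw [norm_mul, RCLike.norm_ofReal, abs_of_pos (inv_pos.2 hz'), inv_mul_cancel₀ hz'.ne'])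
      refine ⟨_, Finset.mem_image_of_mem _ hu, ?_⟩
      rw [mul_left_comm, RCLike.re_ofReal_mul, ← div_eq_inv_mul, lt_div_iff₀ hz'] at h
      exact h.le

/-- Pigeonhole on finitely many rotations: among `s.card * p` indices of large modulus, `p` share a
unit scalar `v` making the real part of `v • f` large. -/
theorem exists_card_eq_forall_lt_re {y : ℕ → E} {c c' : ℝ} (hc : 0 < c) (hcc' : c' < c)
    (h : ¬ UniformlyWeaklyWithin 𝕜 y 0 c) (p : ℕ) :
    ∃ f : StrongDual 𝕜 E, ‖f‖ ≤ 1 ∧ ∃ F : Finset ℕ, F.card = p ∧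
      ∀ i ∈ F, c' < RCLike.re (f (y i)) := by
  obtain ⟨r, hr, hr1⟩ := exists_between (max_lt ((div_lt_one hc).2 hcc') one_pos)
  obtain ⟨s, hs, hsz⟩ := exists_finset_re_mul_ge 𝕜 hr1
  simp only [UniformlyWeaklyWithin, not_exists, not_forall, not_le, sub_zero] at h
  obtain ⟨f, hf, hcard⟩ := h (s.card * p)
  obtain ⟨t, ht, htc⟩ := Set.exists_subset_encard_eq hcard.le
  have htf : t.Finite := Set.finite_of_encard_eq_coe htc
  lift t to Finset ℕ using htf
  rw [Set.encard_coe_eq_coe_finsetCard] at htc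
  choose u hu huz using fun k => hsz (f (y k))
  obtain ⟨v, hv, hvp⟩ := Finset.exists_le_card_fiber_of_mul_le_card_of_maps_to
    (s := t) (t := s) (f := u) (n := p) (fun k _ => hu k) ⟨_, hu 0⟩ (by exact_mod_cast htc.ge)
  obtain ⟨F, hF, rfl⟩ := Finset.exists_subset_card_eq hvp
  refine ⟨v • f, by rw [norm_smul, hs v hv, one_mul]; exact hf, F, rfl, fun i hi => ?_⟩
  obtain ⟨hit, hiv⟩ := Finset.mem_filter.1 (hF hi)
  have h1 : c < ‖f (y i)‖ := ht hit
  have h2 := huz i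
  rw [hiv] at h2
  have hr0 : 0 < r := (le_max_right _ _).trans_lt hr
  calc c' < r * c := (div_lt_iff₀ hc).1 ((le_max_left _ _).trans_lt hr)
    _ ≤ r * ‖f (y i)‖ := by gcongr
    _ ≤ _ := h2

/-- If the positive and negative parts of `α` have masses `P ≥ N`, the functional for the positive
set gives at least `c P - η N ≥ (c - η) / 2 * (P + N)`. -/
theorem mul_sum_abs_le_norm_sum_of_sum_nonneg {y : ℕ → E} {c η : ℝ} (hη : 0 ≤ η) (hc : 0 ≤ c)
    {F : Finset ℕ}
    (h : ∀ G ⊆ F, ∃ f : StrongDual 𝕜 E, ‖f‖ ≤ 1 ∧ (∀ i ∈ G, c < RCLike.re (f (y i))) ∧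
      ∀ i ∈ F \ G, RCLike.re (f (y i)) ≤ η) {α : ℕ → ℝ} (hα : 0 ≤ ∑ i ∈ F, α i) :
    (c - η) / 2 * ∑ i ∈ F, |α i| ≤ ‖∑ i ∈ F, (α i : 𝕜) • y i‖ := by
  obtain ⟨f, hf, hG, hH⟩ := h (F.filter fun i => 0 < α i) (Finset.filter_subset _ _)
  have hterm : ∀ i ∈ F, c * ((|α i| + α i) / 2) - η * ((|α i| - α i) / 2)
      ≤ α i * RCLike.re (f (y i)) := by
    intro i hi
    rcases lt_or_ge 0 (α i) with h0 | h0
    · have := hG i (Finset.mem_filter.2 ⟨hi, h0⟩)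
      rw [abs_of_pos h0]
      nlinarith
    · have := hH i (Finset.mem_sdiff.2 ⟨hi, fun h => (Finset.mem_filter.1 h).2.not_ge h0⟩)
      rw [abs_of_nonpos h0]
      nlinarith
  have hsum := Finset.sum_le_sum hterm
  rw [Finset.sum_sub_distrib, ← Finset.mul_sum, ← Finset.mul_sum, ← Finset.sum_div,
    ← Finset.sum_div, Finset.sum_add_distrib, Finset.sum_sub_distrib] at hsum
  calc (c - η) / 2 * ∑ i ∈ F, |α i| ≤ ∑ i ∈ F, α i * RCLike.re (f (y i)) := by nlinarith
    _ = RCLike.re (f (∑ i ∈ F, (α i : 𝕜) • y i)) := by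
      simp [map_sum]
    _ ≤ ‖f (∑ i ∈ F, (α i : 𝕜) • y i)‖ := RCLike.re_le_norm _
    _ ≤ ‖∑ i ∈ F, (α i : 𝕜) • y i‖ := f.le_of_opNorm_le_of_le hf le_rfl |>.trans (one_mul _).le

theorem mul_sum_abs_le_norm_sum {y : ℕ → E} {c η : ℝ} (hη : 0 ≤ η) (hc : 0 ≤ c)
    {F : Finset ℕ}
    (h : ∀ G ⊆ F, ∃ f : StrongDual 𝕜 E, ‖f‖ ≤ 1 ∧ (∀ i ∈ G, c < RCLike.re (f (y i))) ∧
      ∀ i ∈ F \ G, RCLike.re (f (y i)) ≤ η) (α : ℕ → ℝ) :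
    (c - η) / 2 * ∑ i ∈ F, |α i| ≤ ‖∑ i ∈ F, (α i : 𝕜) • y i‖ := by
  rcases le_total 0 (∑ i ∈ F, α i) with h0 | h0
  · exact mul_sum_abs_le_norm_sum_of_sum_nonneg hη hc h h0
  · simpa using mul_sum_abs_le_norm_sum_of_sum_nonneg hη hc h (α := fun i => -α i) (by simpa using h0)

/-- A weakly null sequence none of whose subsequences is uniformly weakly within `c` has a
subsequence generating an `ℓ₁`-spreading model with any constant smaller than `c / 2`. -/
theorem exists_generatesL1SpreadingModel {y : ℕ → E}
    (hy : ∀ f : StrongDual 𝕜 E, Tendsto (fun k => f (y k)) atTop (𝓝 0)) {c δ : ℝ}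
    (hδ : 0 < δ) (hδc : 2 * δ < c)
    (h : ∀ φ : ℕ → ℕ, StrictMono φ → ¬ UniformlyWeaklyWithin 𝕜 (y ∘ φ) 0 c) :
    ∃ φ : ℕ → ℕ, StrictMono φ ∧ GeneratesL1SpreadingModel 𝕜 (y ∘ φ) δ := by
  obtain ⟨c', h1, h2⟩ := exists_between hδc
  -- This `η` is positive and makes `(c' - η) / 2` exactly `δ`.
  obtain ⟨φ, hφ, hsep⟩ := exists_strictMono_separated (c := c') (η := c' - 2 * δ)
    (K := {g | ∃ f : StrongDual 𝕜 E, ‖f‖ ≤ 1 ∧ g = fun k => RCLike.re (f (y k))})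
    (fun T hT => by
      obtain ⟨s, hsT, hs⟩ := exists_finset_forall_exists_re_le hy (sub_pos.2 h1) hT
      refine ⟨s, hsT, ?_⟩
      rintro ⟨_, ⟨f, hf, rfl⟩, hlt⟩
      obtain ⟨t, ht, hle⟩ := hs f hf
      exact (hlt t ht).not_ge hle)
    (fun φ hφ p => by
      obtain ⟨f, hf, F, hF, hlt⟩ := exists_card_eq_forall_lt_re (by linarith) h2 (h φ hφ) p
      exact ⟨_, ⟨f, hf, rfl⟩, F, hF, hlt⟩)
  refine ⟨φ, hφ, fun F hF α => ?_⟩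
  convert mul_sum_abs_le_norm_sum (𝕜 := 𝕜) (y := y ∘ φ) (c := c') (η := c' - 2 * δ) (by linarith)
    (by linarith) (F := F) ?_ α using 2
  · ring
  · intro G hG
    obtain ⟨_, ⟨f, hf, rfl⟩, hlt, hle⟩ := hsep F hF G hG
    exact ⟨f, hf, hlt, hle⟩

theorem twu_le_two_mul_sm {A : Set E} {x : ℕ → E} (hx : ∀ k, x k ∈ A) {a : E}
    (hxa : WeaklyTendsto 𝕜 x a) : twu 𝕜 x a ≤ 2 * sm 𝕜 A := by
  by_contra! hlt
  have hlt' : sm 𝕜 A < twu 𝕜 x a / 2 := by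
    rw [ENNReal.lt_div_iff_mul_lt (by simp) (by simp), mul_comm]; exact hlt
  obtain ⟨δ, h1, h2⟩ := ENNReal.lt_iff_exists_nnreal_btwn.1 hlt'
  obtain ⟨δ', h3, h4⟩ := ENNReal.lt_iff_exists_nnreal_btwn.1 h2
  have hδ : 0 < δ := ENNReal.coe_pos.1 (bot_le.trans_lt h1)
  have hδδ' : δ < δ' := ENNReal.coe_lt_coe.1 h3
  have hy : ∀ f : StrongDual 𝕜 E, Tendsto (fun k => f (x k - a)) atTop (𝓝 0) := fun f => by
    simpa using (hxa.tendsto_apply f).sub_const (f a)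
  obtain ⟨φ, hφ, hgen⟩ := exists_generatesL1SpreadingModel hy (c := 2 * δ') (δ := δ)
    (by exact_mod_cast hδ) (by exact_mod_cast (mul_lt_mul_iff_right₀ two_pos).2 hδδ')
    (fun φ hφ hU => by
      have hU' : UniformlyWeaklyWithin 𝕜 (x ∘ φ) a (2 * δ') := by
        simpa [UniformlyWeaklyWithin] using hU
      have : twu 𝕜 x a ≤ ENNReal.ofReal (2 * δ') :=
        (iInf₂_le φ hφ).trans ((iInf₂_le (2 * δ' : ℝ)
          (mul_pos two_pos (NNReal.coe_pos.2 (hδ.trans hδδ')))).trans (iInf_le _ hU'))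
      rw [ENNReal.ofReal_mul zero_le_two, ENNReal.ofReal_coe_nnreal, ENNReal.ofReal_ofNat] at this
      rw [ENNReal.lt_div_iff_mul_lt (by simp) (by simp), mul_comm] at h4
      exact h4.not_ge this)
  refine h1.not_ge ?_
  rw [← ENNReal.ofReal_coe_nnreal]
  exact le_iSup₂_of_le (δ : ℝ) (NNReal.coe_pos.2 hδ) (le_iSup_of_le
    ⟨x ∘ φ, a, fun k => hx _, hxa.comp hφ, hgen⟩ le_rfl)

theorem swu_le_two_mul_sm (A : Set E) : swu 𝕜 A ≤ 2 * sm 𝕜 A :=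
  iSup₂_le fun _ hx => iSup₂_le fun _ hxa => twu_le_two_mul_sm hx hxa

end SpreadingModel

/-! ### Cesàro means: `wbs ≤ 2 swu` and `2 sm ≤ wbs`. -/

section Cesaro

variable {𝕜 : Type*} [RCLike 𝕜] {E : Type*} [NormedAddCommGroup E] [NormedSpace 𝕜 E]

theorem cesaroMean_sub_const (x : ℕ → E) (a : E) (n : ℕ) :
    cesaroMean 𝕜 (fun k => x k - a) n = cesaroMean 𝕜 x n - a := by
  have h : ((n : 𝕜) + 1) ≠ 0 := Nat.cast_add_one_ne_zero n
  simp only [cesaroMean, Finset.sum_sub_distrib, Finset.sum_const, Finset.card_range, smul_sub]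
  rw [← Nat.cast_smul_eq_nsmul 𝕜, smul_smul, Nat.cast_succ, inv_mul_cancel₀ h, one_smul]

theorem norm_cesaroMean_le {y : ℕ → E} {B ε : ℝ} (hB : ∀ k, ‖y k‖ ≤ B) (hε : 0 ≤ ε) {N : ℕ}
    (h : ∀ f : StrongDual 𝕜 E, ‖f‖ ≤ 1 → {k : ℕ | ε < ‖f (y k)‖}.encard ≤ (N : ℕ∞)) (n : ℕ) :
    ‖cesaroMean 𝕜 y n‖ ≤ ε + N * B / (n + 1) := by
  obtain ⟨f, hf, hfx⟩ := exists_dual_vector'' 𝕜 (cesaroMean 𝕜 y n)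
  have hB0 : 0 ≤ B := (norm_nonneg _).trans (hB 0)
  have hn : (0 : ℝ) < n + 1 := n.cast_add_one_pos
  have hcard : (((Finset.range (n + 1)).filter fun k => ε < ‖f (y k)‖).card : ℝ) ≤ N := by
    have h1 : ((((Finset.range (n + 1)).filter fun k => ε < ‖f (y k)‖) : Finset ℕ) : Set ℕ).encard
        ≤ N := (Set.encard_le_encard (by intro k; simp)).trans (h f hf)
    rw [Set.encard_coe_eq_coe_finsetCard] at h1
    exact_mod_cast h1
  have hterm : ∀ k, ‖f (y k)‖ ≤ ε + if ε < ‖f (y k)‖ then B else 0 := by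
    intro k
    split_ifs with hk
    · have := (f.le_of_opNorm_le_of_le hf (hB k)).trans (one_mul _).le
      linarith
    · linarith
  have hsum : ∑ k ∈ Finset.range (n + 1), ‖f (y k)‖ ≤ (n + 1) * ε + N * B := by
    refine (Finset.sum_le_sum fun k _ => hterm k).trans ?_
    rw [Finset.sum_add_distrib, Finset.sum_const, Finset.card_range, ← Finset.sum_filter,
      Finset.sum_const, nsmul_eq_mul, nsmul_eq_mul]
    push_cast
    gcongr
  have hnorm : ‖((n : 𝕜) + 1)⁻¹‖ = ((n : ℝ) + 1)⁻¹ := by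
    rw [norm_inv, ← Nat.cast_succ, RCLike.norm_natCast, Nat.cast_succ]
  calc ‖cesaroMean 𝕜 y n‖ = ‖f (cesaroMean 𝕜 y n)‖ := by rw [hfx]; simp
    _ = ((n : ℝ) + 1)⁻¹ * ‖∑ k ∈ Finset.range (n + 1), f (y k)‖ := by
      rw [cesaroMean, map_smul, norm_smul, hnorm, map_sum]
    _ ≤ ((n : ℝ) + 1)⁻¹ * ((n + 1) * ε + N * B) := by
      gcongr
      exact (norm_sum_le _ _).trans hsum
    _ = ε + N * B / (n + 1) := by field_simp

theorem ca_le_of_eventually {z : ℕ → E} {a : E} {r : ℝ} (h : ∀ᶠ n in atTop, ‖z n - a‖ ≤ r) :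
    ca z ≤ ENNReal.ofReal (2 * r) := by
  obtain ⟨n, hn⟩ := eventually_atTop.1 h
  refine iInf_le_of_le n (iSup₂_le fun k hk => iSup₂_le fun l hl => ?_)
  rw [← ofReal_norm]
  refine ENNReal.ofReal_le_ofReal ?_
  have := norm_sub_le (z k - a) (z l - a)
  rw [sub_sub_sub_cancel_right] at this
  linarith [hn k hk, hn l hl]

theorem cca_le_two_mul_wu {x : ℕ → E} {a : E} {B : ℝ} (hB : ∀ k, ‖x k - a‖ ≤ B) :
    cca 𝕜 x ≤ 2 * wu 𝕜 x a := by
  rw [mul_comm, ← ENNReal.div_le_iff_le_mul (by simp) (by simp)]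
  refine le_iInf₂ fun ε hε => le_iInf fun ⟨N, hN⟩ => ?_
  rw [ENNReal.div_le_iff_le_mul (by simp) (by simp), mul_comm]
  have hlim : Tendsto (fun n : ℕ => ε + N * B / ((n : ℝ) + 1)) atTop (𝓝 ε) := by
    simpa using (tendsto_const_nhds.div_atTop
      (tendsto_natCast_atTop_atTop.atTop_add tendsto_const_nhds)).const_add ε
  refine le_of_forall_gt_imp_ge_of_dense fun b hb => ?_
  obtain ⟨b', h1, h2⟩ := ENNReal.lt_iff_exists_nnreal_btwn.1 hb
  have hεb : ε < b' / 2 := by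
    rw [← ENNReal.ofReal_ofNat 2, ← ENNReal.ofReal_mul zero_le_two, ← ENNReal.ofReal_coe_nnreal,
      ENNReal.ofReal_lt_ofReal_iff_of_nonneg (by positivity)] at h1
    linarith
  refine (ca_le_of_eventually (a := a) (r := b' / 2) ?_).trans ?_
  · filter_upwards [hlim.eventually_lt_const hεb] with n hn
    rw [← cesaroMean_sub_const]
    exact (norm_cesaroMean_le hB hε.le hN n).trans hn.le
  · rw [mul_div_cancel₀ _ two_ne_zero, ENNReal.ofReal_coe_nnreal]
    exact h2.le

theorem exists_forall_norm_sub_le {A : Set E} (hA : Bornology.IsBounded A) (a : E) :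
    ∃ B, ∀ x ∈ A, ‖x - a‖ ≤ B := by
  obtain ⟨R, hR⟩ := hA.exists_norm_le
  exact ⟨R + ‖a‖, fun x hx => (norm_sub_le _ _).trans (by gcongr; exact hR x hx)⟩

theorem wbs_le_two_mul_swu {A : Set E} (hA : Bornology.IsBounded A) :
    wbs 𝕜 A ≤ 2 * swu 𝕜 A := by
  refine iSup₂_le fun x hx => iSup_le fun ⟨a, hxa⟩ => ?_
  obtain ⟨B, hB⟩ := exists_forall_norm_sub_le hA a
  calc tcca 𝕜 x ≤ 2 * twu 𝕜 x a := by
        rw [mul_comm, ← ENNReal.div_le_iff_le_mul (by simp) (by simp)]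
        refine le_iInf₂ fun φ hφ => ?_
        rw [ENNReal.div_le_iff_le_mul (by simp) (by simp), mul_comm]
        exact (iInf₂_le φ hφ).trans (cca_le_two_mul_wu fun k => hB _ (hx _))
    _ ≤ 2 * swu 𝕜 A := by
        gcongr
        exact le_iSup₂_of_le x hx (le_iSup₂_of_le a hxa le_rfl)

/-- The difference of the Cesàro means of orders `N ≤ M` of a sequence which satisfies the lower
`ℓ₁`-estimate on `{K, ..., M - 1}`. -/
theorem le_norm_cesaroMean_sub {w : ℕ → E} {δ B : ℝ} (hδ : 0 ≤ δ) (hB : ∀ k, ‖w k‖ ≤ B) {K n m : ℕ}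
    (hKn : K ≤ n + 1) (hnm : n ≤ m)
    (h : ∀ α : ℕ → ℝ, δ * ∑ i ∈ Finset.Ico K (m + 1), |α i|
      ≤ ‖∑ i ∈ Finset.Ico K (m + 1), (α i : 𝕜) • w i‖) :
    2 * δ * (1 - (n + 1) / (m + 1)) - (δ + B) * (K / (n + 1))
      ≤ ‖cesaroMean 𝕜 w n - cesaroMean 𝕜 w m‖ := by
  have hn : (0 : ℝ) < n + 1 := n.cast_add_one_pos
  have hm : (0 : ℝ) < m + 1 := m.cast_add_one_pos
  have hnm' : (n : ℝ) + 1 ≤ m + 1 := by gcongr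
  have hinv : ((m : ℝ) + 1)⁻¹ ≤ ((n : ℝ) + 1)⁻¹ := inv_anti₀ hn hnm'
  have hB0 : 0 ≤ B := (norm_nonneg _).trans (hB 0)
  -- Coefficients of the difference of means, of total mass `2 * (1 - (n + 1) / (m + 1))`; the
  -- indices below `K` go into the error term.
  set α : ℕ → ℝ := fun i => (if i < n + 1 then ((n : ℝ) + 1)⁻¹ else 0) - ((m : ℝ) + 1)⁻¹ with hα
  have hα1 : ∀ i, i < n + 1 → |α i| = ((n : ℝ) + 1)⁻¹ - ((m : ℝ) + 1)⁻¹ := fun i hi => by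
    simp only [hα, if_pos hi]
    exact abs_of_nonneg (sub_nonneg.2 hinv)
  have hα2 : ∀ i, n + 1 ≤ i → |α i| = ((m : ℝ) + 1)⁻¹ := fun i hi => by
    simp only [hα, if_neg hi.not_gt, zero_sub, abs_neg]
    exact abs_of_pos (inv_pos.2 hm)
  have hdiff : cesaroMean 𝕜 w n - cesaroMean 𝕜 w m
      = ∑ i ∈ Finset.range K, (α i : 𝕜) • w i + ∑ i ∈ Finset.Ico K (m + 1), (α i : 𝕜) • w i := by
    rw [Finset.sum_range_add_sum_Ico _ (by omega)]
    have h1 : ∀ i, (α i : 𝕜) • w i = (if i < n + 1 then ((n : 𝕜) + 1)⁻¹ • w i else 0)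
        - ((m : 𝕜) + 1)⁻¹ • w i := fun i => by
      simp only [hα]
      split_ifs <;> simp [sub_smul]
    simp_rw [h1, Finset.sum_sub_distrib, ← Finset.sum_filter, cesaroMean, Finset.smul_sum]
    congr 2
    ext i
    simp
    omega
  have habs : ∑ i ∈ Finset.Ico K (m + 1), |α i|
      = (n + 1 - K) * (((n : ℝ) + 1)⁻¹ - ((m : ℝ) + 1)⁻¹) + (m - n) * ((m : ℝ) + 1)⁻¹ := by
    rw [← Finset.sum_Ico_consecutive _ hKn (by omega : n + 1 ≤ m + 1),
      Finset.sum_congr rfl fun i hi => hα1 i (Finset.mem_Ico.1 hi).2,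
      Finset.sum_congr rfl fun i hi => hα2 i (Finset.mem_Ico.1 hi).1]
    simp [Nat.cast_sub hKn, Nat.cast_sub hnm, mul_sub]
  have hinit : ‖∑ i ∈ Finset.range K, (α i : 𝕜) • w i‖ ≤ B * (K / (n + 1)) := by
    calc _ ≤ ∑ i ∈ Finset.range K, ((n : ℝ) + 1)⁻¹ * B := by
          refine norm_sum_le_of_le _ fun i hi => ?_
          rw [norm_smul, RCLike.norm_ofReal, hα1 i (by have := Finset.mem_range.1 hi; omega)]
          gcongr
          · linarith [inv_pos.2 hm]
          · exact hB i
      _ = B * (K / (n + 1)) := by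
          rw [Finset.sum_const, Finset.card_range, nsmul_eq_mul]
          ring
  have hmain := h α
  rw [habs] at hmain
  have htri := norm_sub_norm_le (∑ i ∈ Finset.Ico K (m + 1), (α i : 𝕜) • w i)
    (-∑ i ∈ Finset.range K, (α i : 𝕜) • w i)
  rw [norm_neg, sub_neg_eq_add, add_comm (∑ i ∈ Finset.Ico K (m + 1), _), ← hdiff] at htri
  have hcomp : 2 * (1 - ((n : ℝ) + 1) / (m + 1)) - K / (n + 1)
      ≤ (n + 1 - K) * (((n : ℝ) + 1)⁻¹ - ((m : ℝ) + 1)⁻¹) + (m - n) * ((m : ℝ) + 1)⁻¹ := by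
    have : (n + 1 - K) * (((n : ℝ) + 1)⁻¹ - ((m : ℝ) + 1)⁻¹) + (m - n) * ((m : ℝ) + 1)⁻¹
        = 2 * (1 - ((n : ℝ) + 1) / (m + 1)) - K / (n + 1) + K * ((m : ℝ) + 1)⁻¹ := by
      field_simp
      ring
    rw [this]
    have : 0 ≤ (K : ℝ) * ((m : ℝ) + 1)⁻¹ := by positivity
    linarith
  have := mul_le_mul_of_nonneg_left hcomp hδ
  linarith

theorem GeneratesL1SpreadingModel.two_mul_le_cca {y : ℕ → E} {δ B : ℝ}
    (hy : GeneratesL1SpreadingModel 𝕜 y δ) (hδ : 0 ≤ δ) (hB : ∀ k, ‖y k‖ ≤ B) {ρ : ℕ → ℕ}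
    (hρ : StrictMono ρ) (hρ2 : ∀ i, 2 ^ i ≤ ρ i) (a : E) :
    ENNReal.ofReal (2 * δ) ≤ cca 𝕜 (fun k => y (ρ k) + a) := by
  have hest : ∀ K : ℕ, ∀ α : ℕ → ℝ, δ * ∑ i ∈ Finset.Ico K (2 ^ K), |α i|
      ≤ ‖∑ i ∈ Finset.Ico K (2 ^ K), (α i : 𝕜) • y (ρ i)‖ := by
    intro K α
    have hcard : ((Finset.Ico K (2 ^ K)).image ρ).card ≤ 2 ^ K :=
      Finset.card_image_le.trans (by simp)
    have h := hy ((Finset.Ico K (2 ^ K)).image ρ) (fun j hj => by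
      obtain ⟨i, hi, rfl⟩ := Finset.mem_image.1 hj
      have h1 := hρ2 i
      have h2 : 2 ^ K ≤ 2 ^ i := Nat.pow_le_pow_right two_pos (Finset.mem_Ico.1 hi).1
      omega) (fun j => α (Function.invFun ρ j))
    simpa [Finset.sum_image hρ.injective.injOn, Function.leftInverse_invFun hρ.injective _] using h
  have hlim : Tendsto (fun K : ℕ => 2 * δ * (1 - (K : ℝ) ^ 2 / 2 ^ K) - (δ + B) * (K : ℝ)⁻¹) atTop
      (𝓝 (2 * δ)) := by
    simpa using (((tendsto_pow_const_div_const_pow_of_one_lt 2 (one_lt_two (α := ℝ))).const_sub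
      1).const_mul (2 * δ)).sub (tendsto_natCast_atTop_atTop.inv_tendsto_atTop.const_mul (δ + B))
  refine le_iInf fun n₀ => ENNReal.le_of_forall_pos_le_add fun r hr _ => ?_
  have hsq : Tendsto (fun K : ℕ => (K : ℝ) ^ 2 / 2 ^ K) atTop (𝓝 0) :=
    tendsto_pow_const_div_const_pow_of_one_lt 2 one_lt_two
  obtain ⟨K, hK1, hK2, hK3⟩ := ((hlim.eventually_const_lt
    (show 2 * δ - r < 2 * δ by simpa using hr)).and
      ((hsq.eventually_lt_const one_pos).and (eventually_gt_atTop n₀))).exists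
  rw [div_lt_one (by positivity)] at hK2
  have hKpow : K ^ 2 < 2 ^ K := by exact_mod_cast hK2
  have hKsq : K ≤ K ^ 2 := Nat.le_self_pow two_ne_zero K
  -- Orders `K ^ 2` and `2 ^ K`: both `K / K ^ 2` and `K ^ 2 / 2 ^ K` vanish in the limit, and `ρ`
  -- maps `[K, 2 ^ K)` to an admissible set.
  obtain ⟨n, hn⟩ : ∃ n, n + 1 = K ^ 2 := ⟨K ^ 2 - 1, by omega⟩
  obtain ⟨m, hm⟩ : ∃ m, m + 1 = 2 ^ K := ⟨2 ^ K - 1, by omega⟩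
  have hnR : (n : ℝ) + 1 = (K : ℝ) ^ 2 := by exact_mod_cast hn
  have hmR : (m : ℝ) + 1 = 2 ^ K := by exact_mod_cast hm
  have hmain := le_norm_cesaroMean_sub (𝕜 := 𝕜) (w := fun i => y (ρ i)) (K := K) (n := n) (m := m)
    hδ (fun k => hB _) (by omega) (by omega) (by rw [hm]; exact hest K)
  have hK0 : (K : ℝ) ≠ 0 := by
    have : K ≠ 0 := by omega
    exact_mod_cast this
  rw [hnR, hmR, show (K : ℝ) / K ^ 2 = (K : ℝ)⁻¹ by field_simp] at hmain
  have hshift : ∀ k, cesaroMean 𝕜 (fun i => y (ρ i)) k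
      = cesaroMean 𝕜 (fun i => y (ρ i) + a) k - a := fun k => by
    rw [← cesaroMean_sub_const]
    simp
  rw [hshift, hshift, sub_sub_sub_cancel_right] at hmain
  calc ENNReal.ofReal (2 * δ)
      ≤ ENNReal.ofReal (‖cesaroMean 𝕜 (fun i => y (ρ i) + a) n
          - cesaroMean 𝕜 (fun i => y (ρ i) + a) m‖ + r) := ENNReal.ofReal_le_ofReal (by linarith)
    _ = ‖cesaroMean 𝕜 (fun i => y (ρ i) + a) n
          - cesaroMean 𝕜 (fun i => y (ρ i) + a) m‖ₑ + r := by
      rw [ENNReal.ofReal_add (norm_nonneg _) r.coe_nonneg, ofReal_norm,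
        ENNReal.ofReal_coe_nnreal]
    _ ≤ _ := by
      gcongr
      exact le_iSup₂_of_le n (by omega) (le_iSup₂_of_le m (by omega) le_rfl)

theorem two_mul_sm_le_wbs {A : Set E} (hA : Bornology.IsBounded A) : 2 * sm 𝕜 A ≤ wbs 𝕜 A := by
  rw [mul_comm, ← ENNReal.le_div_iff_mul_le (by simp) (by simp)]
  refine iSup₂_le fun δ hδ => iSup_le fun ⟨x, a, hx, hxa, hgen⟩ => ?_
  rw [ENNReal.le_div_iff_mul_le (by simp) (by simp), mul_comm, ← ENNReal.ofReal_ofNat 2,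
    ← ENNReal.ofReal_mul zero_le_two]
  obtain ⟨B, hB⟩ := exists_forall_norm_sub_le hA a
  have hpow : StrictMono fun i : ℕ => 2 ^ i := pow_right_strictMono₀ one_lt_two
  -- Thinning out in advance makes every further subsequence sparse enough, as the infimum in `tcca`
  -- requires.
  refine le_iSup₂_of_le (x ∘ fun i => 2 ^ i) (fun k => hx _)
    (le_iSup_of_le ⟨a, hxa.comp hpow⟩ (le_iInf₂ fun φ hφ => ?_))
  simpa [Function.comp_def] using hgen.two_mul_le_cca hδ.le (fun k => hB _ (hx k))
    (hpow.comp hφ) (fun i => Nat.pow_le_pow_right two_pos (hφ.id_le i)) a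

end Cesaro

end BanachSaks

theorem theorem4p1 {𝕜 : Type*} [RCLike 𝕜] {E : Type*} [NormedAddCommGroup E] [NormedSpace 𝕜 E]
    [CompleteSpace E] (A : Set E) (hA : Bornology.IsBounded A) :
    BanachSaks.sm 𝕜 A ≤ (1 / 2) * BanachSaks.wbs 𝕜 A ∧
    (1 / 2) * BanachSaks.wbs 𝕜 A ≤ BanachSaks.swu 𝕜 A ∧
    BanachSaks.swu 𝕜 A ≤ 2 * BanachSaks.sm 𝕜 A := by
  refine ⟨?_, ?_, BanachSaks.swu_le_two_mul_sm A⟩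
  · rw [one_div, mul_comm, ← div_eq_mul_inv, ENNReal.le_div_iff_mul_le (by simp) (by simp),
      mul_comm]
    exact BanachSaks.two_mul_sm_le_wbs hA
  · rw [one_div, mul_comm, ← div_eq_mul_inv, ENNReal.div_le_iff_le_mul (by simp) (by simp),
      mul_comm]
    exact BanachSaks.wbs_le_two_mul_swu hA
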